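/- Let $M$ be a smooth (finite-dimensional, Hausdorff) manifold and $P$ a Poisson tensor on $M$, viewed as a skew-symmetric bundle map $P:T^*M\to TM$, with $\langle P,\alpha\wedge\beta\rangle=\beta(P\alpha)$. Let $$\mu^P(\alpha,\beta)=[\alpha,\beta]^P=\mathcal L_{P\alpha}\beta-\mathcal L_{P\beta}\alpha-\mathrm d\langle P,\alpha\wedge\beta\rangle$$ be the associated bracket of $1$-forms (the same formula defines $\mu^{Q}$ for any bundle map $Q:T^*M\to TM$). For a bilinear product $\mu$ on the smooth sections of a vector bundle and a smooth endomorphism $N$ of the bundle put $$\delta_N\mu(s,t)=\mu(Ns,t)+\mu(s,Nt)-N\mu(s,t),\qquad T_N\mu(s,t)=\mu(Ns,Nt)-N\,\delta_N\mu(s,t);$$ $N$ is a Nijenhuis tensor for $\mu$ if its Nijenhuis torsion $T_N\mu$ vanishes. Let $N:T^*M\to T^*M$ be a Nijenhuis tensor for $\mu^P$, let ${}^tN:TM\to TM$ be its dual bundle map, and assume $PN={}^tN\,P$. (1) The Nijenhuis torsion $T_{{}^tN}$ of ${}^tN$ with respect to the Lie bracket of vector fields vanishes on vector fields in the image of $P$: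 if $X,Y$ are smooth vector fields with $X_x,Y_x\in P(T_x^*M)$ for all $x\in M$, then $T_{{}^tN}(X,Y)=0$. (2) In particular, if $P$ is invertible (i.e. comes from a symplectic structure) and the contracted bracket $\mu^P_N=\delta_N\mu^P$ equals $\mu^{PN}$, then $(P,{}^tN)$ is a Poisson–Nijenhuis structure, i.e. $P$ is a Poisson tensor, ${}^tN$ is a smooth Nijenhuis tensor for the Lie bracket of vector fields, ${}^tN\,P=P\,N$, and the concomitant $$C(P,{}^tN)(\alpha,\beta)=[\alpha,\beta]^{{}^tN P}-\bigl([N\alpha,\beta]^P+[\alpha,N\beta]^P-N[\alpha,\beta]^P\bigr)$$ vanishes for all smooth $1$-forms $\alpha,\beta$. -/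

import Mathlib

open Bundle VectorField
open scoped Manifold ContDiff

noncomputable section

namespace PoissonContraction

/-! ### Linear algebra: transposes -/

section Transpose

variable {E : Type*} [NormedAddCommGroup E] [NormedSpace ℝ E]

/-- The dual `φ ↦ φ ∘ A` of an endomorphism `A` of `E`, acting on the dual space. -/
def dualMapCLM (A : E →L[ℝ] E) : (E →L[ℝ] ℝ) →L[ℝ] (E →L[ℝ] ℝ) :=
  (ContinuousLinearMap.compL ℝ E E ℝ).flip A

variable [FiniteDimensional ℝ E]

/-- Every endomorphism of the dual of a finite-dimensional space is the dual of a unique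
endomorphism of the space. -/
theorem existsUnique_transpose (B : (E →L[ℝ] ℝ) →L[ℝ] (E →L[ℝ] ℝ)) :
    ∃! A : E →L[ℝ] E, ∀ (φ : E →L[ℝ] ℝ) (v : E), φ (A v) = B φ v := by
  let b := Module.finBasis ℝ E
  let c : Fin (Module.finrank ℝ E) → (E →L[ℝ] ℝ) := fun i =>
    LinearMap.toContinuousLinearMap (b.coord i)
  have hc : ∀ φ : E →L[ℝ] ℝ, φ = ∑ i, φ (b i) • c i := by
    intro φ
    ext v
    conv_lhs => rw [← b.sum_repr v, map_sum]
    simp [c, mul_comm, -Module.Basis.sum_repr]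
  refine ⟨∑ i, (B (c i)).smulRight (b i), ?_, ?_⟩
  · intro φ v
    conv_rhs => rw [hc φ]
    simp [mul_comm]
  · intro A hA
    ext v
    apply b.ext_elem
    intro j
    have h := hA (c j) v
    simp only [c, LinearMap.coe_toContinuousLinearMap', Module.Basis.coord_apply] at h
    rw [h]
    simp [c, Finsupp.single_apply]

/-- The transpose of an endomorphism `B` of the dual of a finite-dimensional space `E`, as an
endomorphism of `E` (through `E = E**`): `φ (ᵗB v) = (B φ) v`. -/
def transposeCLM (B : (E →L[ℝ] ℝ) →L[ℝ] (E →L[ℝ] ℝ)) : E →L[ℝ] E :=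
  (existsUnique_transpose B).choose

theorem apply_transposeCLM (B : (E →L[ℝ] ℝ) →L[ℝ] (E →L[ℝ] ℝ)) (φ : E →L[ℝ] ℝ) (v : E) :
    φ (transposeCLM B v) = B φ v :=
  (existsUnique_transpose B).choose_spec.1 φ v

end Transpose

/-! ### Brackets of sections and Nijenhuis torsion -/

section Torsion

variable {M : Type*} {V : M → Type*} [∀ x, TopologicalSpace (V x)] [∀ x, AddCommGroup (V x)]
  [∀ x, Module ℝ (V x)]

/-- The deformed product `δ_N μ (s, t) = μ(N s, t) + μ(s, N t) - N μ(s, t)` of sections. -/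
def deformedBracket (μ : (Π x, V x) → (Π x, V x) → Π x, V x) (N : Π x, V x →L[ℝ] V x)
    (s t : Π x, V x) (x : M) : V x :=
  μ (fun y => N y (s y)) t x + μ s (fun y => N y (t y)) x - N x (μ s t x)

/-- The Nijenhuis torsion `T_N μ (s, t) = μ(N s, N t) - N (δ_N μ (s, t))`. -/
def nijenhuisTorsion (μ : (Π x, V x) → (Π x, V x) → Π x, V x) (N : Π x, V x →L[ℝ] V x)
    (s t : Π x, V x) (x : M) : V x :=
  μ (fun y => N y (s y)) (fun y => N y (t y)) x - N x (deformedBracket μ N s t x)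

end Torsion

/-! ### Tensor fields on a manifold -/

section Manifold

variable {E : Type*} [NormedAddCommGroup E] [NormedSpace ℝ E]
  {M : Type*} [TopologicalSpace M] [ChartedSpace E M]

/-- The cotangent space `T*_x M`. -/
abbrev Cotangent (E : Type*) [NormedAddCommGroup E] [NormedSpace ℝ E] {M : Type*}
    [TopologicalSpace M] [ChartedSpace E M] (x : M) : Type _ :=
  TangentSpace 𝓘(ℝ, E) x →L[ℝ] ℝ

/-- Differential of a real function, as a 1-form. -/
def differential (f : M → ℝ) (x : M) : Cotangent E x := mvfderiv 𝓘(ℝ, E) f x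

/-- The expression of a 1-form in the preferred chart at `x₀`: its pullback by the inverse of the
chart. -/
def inChart (β : Π x : M, Cotangent E x) (x₀ : M) (y : E) : E →L[ℝ] ℝ :=
  (β ((extChartAt 𝓘(ℝ, E) x₀).symm y)).comp
    (mfderiv 𝓘(ℝ, E) 𝓘(ℝ, E) (extChartAt 𝓘(ℝ, E) x₀).symm y)

/-- Exterior derivative of a 1-form: `extDerivOne β x u = (dβ)_x(u, ·)`, computed in the preferred
chart at `x` by `dβ(u, v) = (D_u β)(v) - (D_v β)(u)`. -/
def extDerivOne (β : Π x : M, Cotangent E x) (x : M) (u : TangentSpace 𝓘(ℝ, E) x) :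
    Cotangent E x :=
  let D : E →L[ℝ] E →L[ℝ] ℝ := fderiv ℝ (inChart β x) (extChartAt 𝓘(ℝ, E) x x)
  let A : TangentSpace 𝓘(ℝ, E) x →L[ℝ] E :=
    mfderiv 𝓘(ℝ, E) 𝓘(ℝ, E) (extChartAt 𝓘(ℝ, E) x) x
  ((D - D.flip) (A u)).comp A

/-- Lie derivative of a 1-form along a vector field: `L_X β = ι_X dβ + d(β(X))`. -/
def lieDeriv (X : Π x : M, TangentSpace 𝓘(ℝ, E) x) (β : Π x : M, Cotangent E x) (x : M) :
    Cotangent E x :=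
  extDerivOne β x (X x) + differential (fun y => β y (X y)) x

/-- The bracket of 1-forms defined by a bivector field `P`, viewed as a bundle map `T*M → TM`:
`[α, β]^P = L_{Pα} β - L_{Pβ} α - d⟨P, α ∧ β⟩`, where `⟨P, α ∧ β⟩ = β(Pα)`. -/
def formBracket (P : Π x : M, Cotangent E x →L[ℝ] TangentSpace 𝓘(ℝ, E) x)
    (α β : Π x : M, Cotangent E x) (x : M) : Cotangent E x :=
  lieDeriv (fun y => P y (α y)) β x - lieDeriv (fun y => P y (β y)) α x
    - differential (fun y => β y (P y (α y))) x

/-- The Poisson bracket of functions `{f, g}^P = ⟨P, df ∧ dg⟩`. -/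
def poissonBracket (P : Π x : M, Cotangent E x →L[ℝ] TangentSpace 𝓘(ℝ, E) x)
    (f g : M → ℝ) (x : M) : ℝ :=
  differential g x (P x (differential f x))

variable [IsManifold 𝓘(ℝ, E) ∞ M]

/-- Smooth vector fields. -/
def SmoothField (X : Π x : M, TangentSpace 𝓘(ℝ, E) x) : Prop :=
  ContMDiff 𝓘(ℝ, E) (𝓘(ℝ, E).prod 𝓘(ℝ, E)) ∞
    (fun x => TotalSpace.mk' E (E := fun x : M => TangentSpace 𝓘(ℝ, E) x) x (X x))

/-- Smooth 1-forms. -/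
def SmoothForm (α : Π x : M, Cotangent E x) : Prop :=
  ContMDiff 𝓘(ℝ, E) (𝓘(ℝ, E).prod 𝓘(ℝ, E →L[ℝ] ℝ)) ∞
    (fun x => TotalSpace.mk' (E →L[ℝ] ℝ) (E := fun x : M => Cotangent E x) x (α x))

/-- Smooth bundle maps `TM → TM`. -/
def SmoothEndTangent (A : Π x : M, TangentSpace 𝓘(ℝ, E) x →L[ℝ] TangentSpace 𝓘(ℝ, E) x) : Prop :=
  ContMDiff 𝓘(ℝ, E) (𝓘(ℝ, E).prod 𝓘(ℝ, E →L[ℝ] E)) ∞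
    (fun x => TotalSpace.mk' (E →L[ℝ] E)
      (E := fun x : M => TangentSpace 𝓘(ℝ, E) x →L[ℝ] TangentSpace 𝓘(ℝ, E) x) x (A x))

/-- Smooth bundle maps `T*M → T*M`. -/
def SmoothEndCotangent (N : Π x : M, Cotangent E x →L[ℝ] Cotangent E x) : Prop :=
  ContMDiff 𝓘(ℝ, E) (𝓘(ℝ, E).prod 𝓘(ℝ, (E →L[ℝ] ℝ) →L[ℝ] (E →L[ℝ] ℝ))) ∞
    (fun x => TotalSpace.mk' ((E →L[ℝ] ℝ) →L[ℝ] (E →L[ℝ] ℝ))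
      (E := fun x : M => Cotangent E x →L[ℝ] Cotangent E x) x (N x))

/-- Smooth bundle maps `T*M → TM`. -/
def SmoothBivectorMap (P : Π x : M, Cotangent E x →L[ℝ] TangentSpace 𝓘(ℝ, E) x) : Prop :=
  ContMDiff 𝓘(ℝ, E) (𝓘(ℝ, E).prod 𝓘(ℝ, (E →L[ℝ] ℝ) →L[ℝ] E)) ∞
    (fun x => TotalSpace.mk' ((E →L[ℝ] ℝ) →L[ℝ] E)
      (E := fun x : M => Cotangent E x →L[ℝ] TangentSpace 𝓘(ℝ, E) x) x (P x))

/-- A Poisson tensor: a smooth skew-symmetric bivector field whose bracket of functions satisfies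
the Jacobi identity. -/
structure IsPoisson (P : Π x : M, Cotangent E x →L[ℝ] TangentSpace 𝓘(ℝ, E) x) : Prop where
  smooth : SmoothBivectorMap P
  skew : ∀ (x : M) (α β : Cotangent E x), β (P x α) = -α (P x β)
  jacobi : ∀ f g h : M → ℝ, ContMDiff 𝓘(ℝ, E) 𝓘(ℝ) ∞ f → ContMDiff 𝓘(ℝ, E) 𝓘(ℝ) ∞ g →
    ContMDiff 𝓘(ℝ, E) 𝓘(ℝ) ∞ h → ∀ x : M,
      poissonBracket P f (poissonBracket P g h) x + poissonBracket P g (poissonBracket P h f) x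
        + poissonBracket P h (poissonBracket P f g) x = 0

/-- `N : T*M → T*M` is a Nijenhuis tensor for the bracket `[·,·]^P` of 1-forms. -/
def IsNijenhuisForForms (P : Π x : M, Cotangent E x →L[ℝ] TangentSpace 𝓘(ℝ, E) x)
    (N : Π x : M, Cotangent E x →L[ℝ] Cotangent E x) : Prop :=
  SmoothEndCotangent N ∧ ∀ α β : Π x : M, Cotangent E x, SmoothForm α → SmoothForm β →
    ∀ x : M, nijenhuisTorsion (formBracket P) N α β x = 0

/-- `A : TM → TM` is a Nijenhuis tensor for the Lie bracket of vector fields. -/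
def IsNijenhuisForFields (A : Π x : M, TangentSpace 𝓘(ℝ, E) x →L[ℝ] TangentSpace 𝓘(ℝ, E) x) :
    Prop :=
  SmoothEndTangent A ∧ ∀ X Y : Π x : M, TangentSpace 𝓘(ℝ, E) x, SmoothField X → SmoothField Y →
    ∀ x : M, nijenhuisTorsion (mlieBracket 𝓘(ℝ, E)) A X Y x = 0

/-- The dual bundle map `T*M → T*M` of `A : TM → TM`. -/
def dualBundleMap (A : Π x : M, TangentSpace 𝓘(ℝ, E) x →L[ℝ] TangentSpace 𝓘(ℝ, E) x) (x : M) :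
    Cotangent E x →L[ℝ] Cotangent E x :=
  dualMapCLM (E := E) (A x)

/-- The dual bundle map `ᵗN : TM → TM` of `N : T*M → T*M`. -/
def transposeBundleMap [FiniteDimensional ℝ E] (N : Π x : M, Cotangent E x →L[ℝ] Cotangent E x)
    (x : M) : TangentSpace 𝓘(ℝ, E) x →L[ℝ] TangentSpace 𝓘(ℝ, E) x :=
  transposeCLM (E := E) (N x)

/-- `(P, A)` is a Poisson–Nijenhuis structure: `P` is a Poisson tensor, `A : TM → TM` is a Nijenhuis
tensor for the Lie bracket of vector fields, `A P = P A*`, and the concomitant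
`C(P, A)(α, β) = [α, β]^{AP} - ([A*α, β]^P + [α, A*β]^P - A*[α, β]^P)` vanishes. -/
structure IsPoissonNijenhuis (P : Π x : M, Cotangent E x →L[ℝ] TangentSpace 𝓘(ℝ, E) x)
    (A : Π x : M, TangentSpace 𝓘(ℝ, E) x →L[ℝ] TangentSpace 𝓘(ℝ, E) x) : Prop where
  poisson : IsPoisson P
  nijenhuis : IsNijenhuisForFields A
  commute : ∀ x : M, (A x).comp (P x) = (P x).comp (dualBundleMap A x)
  concomitant : ∀ α β : Π x : M, Cotangent E x, SmoothForm α → SmoothForm β → ∀ x : M,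
    formBracket (fun y => (A y).comp (P y)) α β x
      - deformedBracket (formBracket P) (dualBundleMap A) α β x = 0

end Manifold

end PoissonContraction

end

open Bundle VectorField Filter
open scoped Manifold ContDiff Topology

noncomputable section

namespace PoissonContraction

/-! If `P` is Poisson, it intertwines the bracket of 1-forms with the Lie bracket: `P[α, β]^P = [Pα,
Pβ]`. Together with `PN = ᵗN P` this gives `T_{ᵗN}(Pα, Pβ) = P (T_N μ^P (α, β)) = 0`.

A field lying pointwise in the image of `P` need not equal `Pα` with `α` smooth, since the rank of
`P` may jump. But the torsion of `ᵗN` is tensorial, so at a given point only the values of the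
fields matter, and these can be matched by `Pα`, `Pβ` with `α`, `β` of constant coefficients in a
chart. The differential of a linear coordinate function, cut off by a bump function, extends such a
form globally, so the hypothesis on `N` applies to it.

The computation is done on `E` in `nijenhuisTorsion_lieBracket_eq_zero`, resting on
`nijenhuisTorsion_lieBracket` (tensoriality) and `lieBracket_eq_flatBracket` (intertwining). It is
transported by `tangentRep_nijenhuisTorsion` and `cotangentRep_nijenhuisTorsion`, while
`IsPoisson.jacobi_localRep` extracts the Schouten identity from the Jacobi identity. When `P` is
invertible every field is in its image, and the concomitant is the difference of the two sides of
the contraction hypothesis. -/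

/-! ### Calculus on a normed space -/

section Flat

variable {E : Type*} [NormedAddCommGroup E] [NormedSpace ℝ E]

/-- The torsion of an endomorphism field of a normed space in terms of its derivative. In
particular it depends on the vector fields only through their values at the point. -/
theorem nijenhuisTorsion_lieBracket {A : E → E →L[ℝ] E} {X Y : E → E} {z : E}
    (hA : DifferentiableAt ℝ A z) (hX : DifferentiableAt ℝ X z) (hY : DifferentiableAt ℝ Y z) :
    nijenhuisTorsion (V := fun _ : E => E) (lieBracket ℝ) A X Y z =
      fderiv ℝ A z (A z (X z)) (Y z) - fderiv ℝ A z (A z (Y z)) (X z)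
        - A z (fderiv ℝ A z (X z) (Y z)) + A z (fderiv ℝ A z (Y z) (X z)) := by
  -- By the Leibniz rule, all terms with a derivative of `X` or `Y` cancel among the four brackets.
  simp only [nijenhuisTorsion, deformedBracket, lieBracket, fderiv_clm_apply hA hX,
    fderiv_clm_apply hA hY, add_apply, ContinuousLinearMap.comp_apply,
    ContinuousLinearMap.flip_apply, map_add, map_sub]
  abel

/-- The bracket of `1`-forms on a normed space defined by a skew-symmetric `p`, in terms of the
derivative of `p`. -/
def flatBracket (p : E → (E →L[ℝ] ℝ) →L[ℝ] E) (a b : E → E →L[ℝ] ℝ) (z : E) : E →L[ℝ] ℝ :=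
  fderiv ℝ b z (p z (a z)) - fderiv ℝ a z (p z (b z)) + (b z).comp ((fderiv ℝ p z).flip (a z))

variable {p : E → (E →L[ℝ] ℝ) →L[ℝ] E} {a b : E → E →L[ℝ] ℝ} {z : E}

theorem flatBracket_apply (v : E) : flatBracket p a b z v =
    fderiv ℝ b z (p z (a z)) v - fderiv ℝ a z (p z (b z)) v + b z (fderiv ℝ p z v (a z)) := rfl

theorem fderiv_pairing (hp : DifferentiableAt ℝ p z) (ha : DifferentiableAt ℝ a z)
    (hb : DifferentiableAt ℝ b z) (v : E) :
    fderiv ℝ (fun y => b y (p y (a y))) z v =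
      fderiv ℝ b z v (p z (a z)) + b z (fderiv ℝ p z v (a z)) + b z (p z (fderiv ℝ a z v)) := by
  rw [fderiv_clm_apply hb (hp.clm_apply ha), fderiv_clm_apply hp ha]
  simp
  ring

/-- The Cartan-type formula for the bracket agrees with `flatBracket`. -/
theorem cartan_eq_flatBracket (hp : DifferentiableAt ℝ p z) (ha : DifferentiableAt ℝ a z)
    (hb : DifferentiableAt ℝ b z)
    (hskew : ∀ᶠ y in 𝓝 z, ∀ ξ η : E →L[ℝ] ℝ, η (p y ξ) = -ξ (p y η)) :
    ((fderiv ℝ b z - (fderiv ℝ b z).flip) (p z (a z)) + fderiv ℝ (fun y => b y (p y (a y))) z)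
      - ((fderiv ℝ a z - (fderiv ℝ a z).flip) (p z (b z)) + fderiv ℝ (fun y => a y (p y (b y))) z)
      - fderiv ℝ (fun y => b y (p y (a y))) z = flatBracket p a b z := by
  -- With this sign the three differentials of pairings collapse to a single one.
  have h : fderiv ℝ (fun y => a y (p y (b y))) z = -fderiv ℝ (fun y => b y (p y (a y))) z := by
    rw [← fderiv_neg]
    apply Filter.EventuallyEq.fderiv_eq
    filter_upwards [hskew] with y hy
    exact hy _ _
  ext v
  have h1 := hskew.self_of_nhds (fderiv ℝ a z v) (b z)
  rw [h]
  simp only [add_apply, sub_apply,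
    neg_apply, ContinuousLinearMap.flip_apply, fderiv_pairing hp ha hb,
    flatBracket_apply, h1]
  ring

theorem fderiv_skew (hp : DifferentiableAt ℝ p z)
    (hskew : ∀ᶠ y in 𝓝 z, ∀ ξ η : E →L[ℝ] ℝ, η (p y ξ) = -ξ (p y η)) (v : E)
    (ξ η : E →L[ℝ] ℝ) : η (fderiv ℝ p z v ξ) = -ξ (fderiv ℝ p z v η) := by
  have key : ∀ ξ η : E →L[ℝ] ℝ, fderiv ℝ (fun y => η (p y ξ)) z v = η (fderiv ℝ p z v ξ) := by
    intro ξ η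
    simpa using fderiv_pairing hp (differentiableAt_const ξ) (differentiableAt_const η) v
  have h : fderiv ℝ (fun y => η (p y ξ)) z = -fderiv ℝ (fun y => ξ (p y η)) z := by
    rw [← fderiv_neg]
    apply Filter.EventuallyEq.fderiv_eq
    filter_upwards [hskew] with y hy
    exact hy _ _
  rw [← key, ← key, h, neg_apply]

/-- If the Schouten bracket of `p` vanishes at `z`, then `p` intertwines the bracket of `1`-forms
and the Lie bracket of vector fields. -/
theorem lieBracket_eq_flatBracket (hp : DifferentiableAt ℝ p z) (ha : DifferentiableAt ℝ a z)
    (hb : DifferentiableAt ℝ b z)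
    (hskew : ∀ᶠ y in 𝓝 z, ∀ ξ η : E →L[ℝ] ℝ, η (p y ξ) = -ξ (p y η))
    (hjac : ∀ ξ η ζ : E →L[ℝ] ℝ, ζ (fderiv ℝ p z (p z ξ) η) + ξ (fderiv ℝ p z (p z η) ζ)
      + η (fderiv ℝ p z (p z ζ) ξ) = 0) :
    lieBracket ℝ (fun y => p y (a y)) (fun y => p y (b y)) z = p z (flatBracket p a b z) := by
  refine (SeparatingDual.eq_iff_forall_dual_eq (R := ℝ)).2 fun ζ => ?_
  -- After pairing with `ζ`, the terms with derivatives of `a` and `b` match by skewness of `p`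
  -- (`h4`, `h5`); those with a derivative of `p` are the Schouten identity `h1`, one of them turned
  -- around by `h2`.
  have h1 := hjac (a z) (b z) ζ
  have h2 := fderiv_skew hp hskew (p z (b z)) (a z) ζ
  replace hskew := hskew.self_of_nhds
  have h3 : ζ (p z (flatBracket p a b z)) = -flatBracket p a b z (p z ζ) := hskew _ _
  have h4 := hskew (fderiv ℝ b z (p z (a z))) ζ
  have h5 := hskew (fderiv ℝ a z (p z (b z))) ζ
  rw [h3, flatBracket_apply, lieBracket, fderiv_clm_apply hp ha, fderiv_clm_apply hp hb]
  simp only [add_apply, ContinuousLinearMap.comp_apply,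
    ContinuousLinearMap.flip_apply, map_add, map_sub]
  linarith

theorem flatBracket_congr {a' b' : E → E →L[ℝ] ℝ} (ha : a =ᶠ[𝓝 z] a') (hb : b =ᶠ[𝓝 z] b') :
    flatBracket p a b z = flatBracket p a' b' z := by
  simp only [flatBracket, ha.fderiv_eq, hb.fderiv_eq, ha.eq_of_nhds, hb.eq_of_nhds]

/-- The torsion of an endomorphism field `A` vanishes on vectors in the image of a Poisson tensor
`p`, if `A` is intertwined by `p` with an endomorphism field `n` of the dual space that is torsion
free for the bracket defined by `p`. -/
theorem nijenhuisTorsion_lieBracket_eq_zero {A : E → E →L[ℝ] E}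
    {n : E → (E →L[ℝ] ℝ) →L[ℝ] (E →L[ℝ] ℝ)} {X Y : E → E}
    (hp : DifferentiableAt ℝ p z) (hA : DifferentiableAt ℝ A z) (hn : DifferentiableAt ℝ n z)
    (hX : DifferentiableAt ℝ X z) (hY : DifferentiableAt ℝ Y z)
    (hskew : ∀ᶠ y in 𝓝 z, ∀ ξ η : E →L[ℝ] ℝ, η (p y ξ) = -ξ (p y η))
    (hjac : ∀ ξ η ζ : E →L[ℝ] ℝ, ζ (fderiv ℝ p z (p z ξ) η) + ξ (fderiv ℝ p z (p z η) ζ)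
      + η (fderiv ℝ p z (p z ζ) ξ) = 0)
    (hcomm : ∀ᶠ y in 𝓝 z, ∀ ξ : E →L[ℝ] ℝ, p y (n y ξ) = A y (p y ξ))
    {ξ η : E →L[ℝ] ℝ} (hξ : p z ξ = X z) (hη : p z η = Y z)
    (htor : nijenhuisTorsion (V := fun _ : E => E →L[ℝ] ℝ) (flatBracket p) n
      (fun _ => ξ) (fun _ => η) z = 0) :
    nijenhuisTorsion (V := fun _ : E => E) (lieBracket ℝ) A X Y z = 0 := by
  have hc : ∀ ξ : E →L[ℝ] ℝ, DifferentiableAt ℝ (fun _ : E => ξ) z :=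
    fun ξ => differentiableAt_const ξ
  have hnc : ∀ ξ : E →L[ℝ] ℝ, DifferentiableAt ℝ (fun y => n y ξ) z :=
    fun ξ => hn.clm_apply (hc ξ)
  have hpc : ∀ ξ : E →L[ℝ] ℝ, DifferentiableAt ℝ (fun y => p y ξ) z :=
    fun ξ => hp.clm_apply (hc ξ)
  have hev : ∀ ξ : E →L[ℝ] ℝ, (fun y => A y (p y ξ)) =ᶠ[𝓝 z] fun y => p y (n y ξ) := by
    intro ξ
    filter_upwards [hcomm] with y hy
    exact (hy ξ).symm
  -- Tensoriality: `X` and `Y` agree with `p ξ` and `p η` at `z` only, and that suffices.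
  have hreduce : nijenhuisTorsion (V := fun _ : E => E) (lieBracket ℝ) A X Y z =
      nijenhuisTorsion (V := fun _ : E => E) (lieBracket ℝ) A (fun y => p y ξ)
        (fun y => p y η) z := by
    rw [nijenhuisTorsion_lieBracket hA hX hY, nijenhuisTorsion_lieBracket hA (hpc ξ) (hpc η),
      hξ, hη]
  have hcz := hcomm.self_of_nhds
  -- Once `A p` is replaced by `p n`, each Lie bracket is `p` of a bracket of forms, and the whole
  -- expression is `p` of the torsion of `n`.
  rw [hreduce, nijenhuisTorsion, deformedBracket,
    (hev ξ).lieBracket_vectorField_eq (hev η),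
    (hev ξ).lieBracket_vectorField_eq (EventuallyEq.refl _ _),
    (EventuallyEq.refl _ _).lieBracket_vectorField_eq (hev η),
    lieBracket_eq_flatBracket hp (hnc ξ) (hnc η) hskew hjac,
    lieBracket_eq_flatBracket hp (hnc ξ) (hc η) hskew hjac,
    lieBracket_eq_flatBracket hp (hc ξ) (hnc η) hskew hjac,
    lieBracket_eq_flatBracket hp (hc ξ) (hc η) hskew hjac,
    ← hcz, ← map_add, ← map_sub, ← hcz, ← map_sub]
  exact (congrArg (p z) htor).trans (map_zero _)

end Flat

/-! ### Sections of vector bundles in the preferred trivialization at a point -/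

section FibreRep

variable {B F F' : Type*} {V V' : B → Type*} [TopologicalSpace B]
  [NormedAddCommGroup F] [NormedSpace ℝ F] [TopologicalSpace (TotalSpace F V)]
  [∀ x, TopologicalSpace (V x)] [∀ x, AddCommGroup (V x)] [∀ x, Module ℝ (V x)]
  [FiberBundle F V] [VectorBundle ℝ F V]
  [NormedAddCommGroup F'] [NormedSpace ℝ F'] [TopologicalSpace (TotalSpace F' V')]
  [∀ x, TopologicalSpace (V' x)] [∀ x, AddCommGroup (V' x)] [∀ x, Module ℝ (V' x)]
  [FiberBundle F' V'] [VectorBundle ℝ F' V']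

/-- The fibre over `y` seen in the preferred trivialization at `x`. -/
def fibreRep (F : Type*) (V : B → Type*) [NormedAddCommGroup F] [NormedSpace ℝ F]
    [TopologicalSpace (TotalSpace F V)] [∀ x, TopologicalSpace (V x)] [∀ x, AddCommGroup (V x)]
    [∀ x, Module ℝ (V x)] [FiberBundle F V] [VectorBundle ℝ F V] (x y : B) : V y →L[ℝ] F :=
  (trivializationAt F V x).continuousLinearMapAt ℝ y

theorem fibreRep_apply {x y : B} (hy : y ∈ (trivializationAt F V x).baseSet) (v : V y) :
    fibreRep F V x y v = (trivializationAt F V x ⟨y, v⟩).2 := by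
  rw [fibreRep, Trivialization.continuousLinearMapAt_apply,
    Trivialization.coe_linearMapAt_of_mem _ hy]

theorem fibreRep_bijective {x y : B} (hy : y ∈ (trivializationAt F V x).baseSet) :
    Function.Bijective (fibreRep F V x y : V y → F) := by
  have := ((trivializationAt F V x).continuousLinearEquivAt ℝ y hy).bijective
  convert this using 1
  ext v
  rw [fibreRep, Trivialization.coe_continuousLinearEquivAt_eq]

variable [∀ x, IsTopologicalAddGroup (V' x)] [∀ x, ContinuousSMul ℝ (V' x)]

theorem fibreRep_clm {x y : B} (hy : y ∈ (trivializationAt F V x).baseSet)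
    (hy' : y ∈ (trivializationAt F' V' x).baseSet) (A : V y →L[ℝ] V' y) :
    fibreRep (F →L[ℝ] F') (fun y => V y →L[ℝ] V' y) x y A = (fibreRep F' V' x y).comp (A.comp
      ((trivializationAt F V x).symmL ℝ y)) := by
  rw [fibreRep_apply (by rw [hom_trivializationAt_baseSet]; exact ⟨hy, hy'⟩),
    hom_trivializationAt_apply]
  rfl

/-- The Hom bundle is trivialized by conjugation with the trivializations of its two factors. Hence
every evaluation of a tensor commutes with passage to the chart. -/
theorem fibreRep_clm_apply {x y : B} (hy : y ∈ (trivializationAt F V x).baseSet)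
    (hy' : y ∈ (trivializationAt F' V' x).baseSet) (A : V y →L[ℝ] V' y) (v : V y) :
    fibreRep (F →L[ℝ] F') (fun y => V y →L[ℝ] V' y) x y A (fibreRep F V x y v) =
      fibreRep F' V' x y (A v) := by
  rw [fibreRep_clm hy hy']
  simp only [ContinuousLinearMap.comp_apply]
  rw [fibreRep, fibreRep, Trivialization.symmL_continuousLinearMapAt _ hy]

end FibreRep

/-! ### Sections as functions on the model space -/

section LocalRep

variable {E : Type*} [NormedAddCommGroup E] [NormedSpace ℝ E]
  {M : Type*} [TopologicalSpace M] [ChartedSpace E M] [IsManifold 𝓘(ℝ, E) ∞ M]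
  {F F' : Type*} {V V' : M → Type*}
  [NormedAddCommGroup F] [NormedSpace ℝ F] [TopologicalSpace (TotalSpace F V)]
  [∀ x, TopologicalSpace (V x)] [∀ x, AddCommGroup (V x)] [∀ x, Module ℝ (V x)]
  [FiberBundle F V] [VectorBundle ℝ F V]
  [NormedAddCommGroup F'] [NormedSpace ℝ F'] [TopologicalSpace (TotalSpace F' V')]
  [∀ x, TopologicalSpace (V' x)] [∀ x, AddCommGroup (V' x)] [∀ x, Module ℝ (V' x)]
  [FiberBundle F' V'] [VectorBundle ℝ F' V']

/-- The expression of a section in the preferred chart and trivialization at `x`. -/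
def localRep (F : Type*) (V : M → Type*) [NormedAddCommGroup F] [NormedSpace ℝ F]
    [TopologicalSpace (TotalSpace F V)] [∀ x, TopologicalSpace (V x)] [∀ x, AddCommGroup (V x)]
    [∀ x, Module ℝ (V x)] [FiberBundle F V] [VectorBundle ℝ F V] (x : M) (s : Π y, V y)
    (z : E) : F :=
  fibreRep F V x ((extChartAt 𝓘(ℝ, E) x).symm z) (s ((extChartAt 𝓘(ℝ, E) x).symm z))

omit [IsManifold 𝓘(ℝ, E) ∞ M] in
theorem tendsto_extChartAt_symm (x : M) :
    Tendsto (extChartAt 𝓘(ℝ, E) x).symm (𝓝 (extChartAt 𝓘(ℝ, E) x x)) (𝓝 x) := by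
  have := continuousAt_extChartAt_symm (I := 𝓘(ℝ, E)) x
  rwa [ContinuousAt, extChartAt_to_inv] at this

omit [IsManifold 𝓘(ℝ, E) ∞ M] in
theorem eventually_symm_mem_baseSet (F : Type*) (V : M → Type*) [TopologicalSpace F]
    [TopologicalSpace (TotalSpace F V)] [∀ x, TopologicalSpace (V x)] [FiberBundle F V] (x : M) :
    ∀ᶠ z in 𝓝 (extChartAt 𝓘(ℝ, E) x x),
      (extChartAt 𝓘(ℝ, E) x).symm z ∈ (trivializationAt F V x).baseSet :=
  tendsto_extChartAt_symm x ((trivializationAt F V x).open_baseSet.mem_nhds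
    (mem_baseSet_trivializationAt F V x))

omit [IsManifold 𝓘(ℝ, E) ∞ M] in
theorem localRep_self (x : M) (s : Π y, V y) :
    localRep F V x s (extChartAt 𝓘(ℝ, E) x x) = fibreRep F V x x (s x) := by
  -- The base point is generalized because the fibres over equal points are different types.
  have : ∀ y, y = x → fibreRep F V x y (s y) = fibreRep F V x x (s x) := by
    rintro y rfl
    rfl
  exact this _ (extChartAt_to_inv x)

theorem differentiableAt_comp_extChartAt_symm {f : M → F} {x : M}
    (hf : ContMDiffAt 𝓘(ℝ, E) 𝓘(ℝ, F) ∞ f x) :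
    DifferentiableAt ℝ (f ∘ (extChartAt 𝓘(ℝ, E) x).symm) (extChartAt 𝓘(ℝ, E) x x) := by
  have h : ContMDiffAt 𝓘(ℝ, E) 𝓘(ℝ, E) ∞ (extChartAt 𝓘(ℝ, E) x).symm
      (extChartAt 𝓘(ℝ, E) x x) :=
    (contMDiffOn_extChartAt_symm x).contMDiffAt (extChartAt_target_mem_nhds x)
  have hf' : ContMDiffAt 𝓘(ℝ, E) 𝓘(ℝ, F) ∞ f
      ((extChartAt 𝓘(ℝ, E) x).symm (extChartAt 𝓘(ℝ, E) x x)) := by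
    rwa [extChartAt_to_inv]
  exact (contMDiffAt_iff_contDiffAt.1 (hf'.comp _ h)).differentiableAt (by simp)

theorem differentiableAt_localRep {s : Π y, V y} {x : M}
    (hs : ContMDiffAt 𝓘(ℝ, E) (𝓘(ℝ, E).prod 𝓘(ℝ, F)) ∞
      (fun y => TotalSpace.mk' F y (s y)) x) :
    DifferentiableAt ℝ (localRep F V x s) (extChartAt 𝓘(ℝ, E) x x) := by
  have h := differentiableAt_comp_extChartAt_symm (contMDiffAt_totalSpace.1 hs).2
  refine h.congr_of_eventuallyEq ?_
  filter_upwards [eventually_symm_mem_baseSet F V x] with z hz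
  exact fibreRep_apply hz _

variable [∀ x, IsTopologicalAddGroup (V' x)] [∀ x, ContinuousSMul ℝ (V' x)]

omit [IsManifold 𝓘(ℝ, E) ∞ M] in
theorem localRep_clm_apply (x : M) (A : Π y, V y →L[ℝ] V' y) (s : Π y, V y) :
    localRep F' V' x (fun y => A y (s y)) =ᶠ[𝓝 (extChartAt 𝓘(ℝ, E) x x)]
      fun z => localRep (F →L[ℝ] F') (fun y => V y →L[ℝ] V' y) x A z (localRep F V x s z) := by
  filter_upwards [eventually_symm_mem_baseSet F V x, eventually_symm_mem_baseSet F' V' x]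
    with z hz hz'
  exact (fibreRep_clm_apply hz hz' _ _).symm

omit [IsManifold 𝓘(ℝ, E) ∞ M] in
theorem fibreRep_self_bijective (x : M) : Function.Bijective (fibreRep F V x x : V x → F) :=
  fibreRep_bijective (mem_baseSet_trivializationAt F V x)

end LocalRep

/-! ### Tensor fields and brackets in the preferred chart -/

section TensorRep

variable {E : Type*} [NormedAddCommGroup E] [NormedSpace ℝ E]
  {M : Type*} [TopologicalSpace M] [ChartedSpace E M] [IsManifold 𝓘(ℝ, E) ∞ M]

/-- Tangent vectors at `y` in the preferred chart at `x`. -/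
abbrev tangentRep (x y : M) : TangentSpace 𝓘(ℝ, E) y →L[ℝ] E :=
  fibreRep E (TangentSpace 𝓘(ℝ, E)) x y

/-- Covectors at `y` in the preferred chart at `x`. -/
abbrev cotangentRep (x y : M) : Cotangent E y →L[ℝ] E →L[ℝ] ℝ :=
  fibreRep (E →L[ℝ] ℝ) (Cotangent E) x y

/-- Bivectors at `y` in the preferred chart at `x`. -/
abbrev bivectorRep (x y : M) :
    (Cotangent E y →L[ℝ] TangentSpace 𝓘(ℝ, E) y) →L[ℝ] (E →L[ℝ] ℝ) →L[ℝ] E :=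
  fibreRep ((E →L[ℝ] ℝ) →L[ℝ] E) (fun y : M => Cotangent E y →L[ℝ] TangentSpace 𝓘(ℝ, E) y) x y

/-- Endomorphisms of the tangent space at `y` in the preferred chart at `x`. -/
abbrev endTangentRep (x y : M) :
    (TangentSpace 𝓘(ℝ, E) y →L[ℝ] TangentSpace 𝓘(ℝ, E) y) →L[ℝ] E →L[ℝ] E :=
  fibreRep (E →L[ℝ] E)
    (fun y : M => TangentSpace 𝓘(ℝ, E) y →L[ℝ] TangentSpace 𝓘(ℝ, E) y) x y

/-- Endomorphisms of the cotangent space at `y` in the preferred chart at `x`. -/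
abbrev endCotangentRep (x y : M) :
    (Cotangent E y →L[ℝ] Cotangent E y) →L[ℝ] (E →L[ℝ] ℝ) →L[ℝ] (E →L[ℝ] ℝ) :=
  fibreRep ((E →L[ℝ] ℝ) →L[ℝ] (E →L[ℝ] ℝ)) (fun y : M => Cotangent E y →L[ℝ] Cotangent E y) x y

/-- A vector field in the preferred chart at `x`. -/
abbrev fieldLocalRep (x : M) (X : Π y : M, TangentSpace 𝓘(ℝ, E) y) : E → E :=
  localRep E (TangentSpace 𝓘(ℝ, E)) x X

/-- A `1`-form in the preferred chart at `x`. -/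
abbrev formLocalRep (x : M) (β : Π y : M, Cotangent E y) : E → E →L[ℝ] ℝ :=
  localRep (E →L[ℝ] ℝ) (Cotangent E) x β

/-- A bundle map `T*M → TM` in the preferred chart at `x`. -/
abbrev bivectorLocalRep (x : M) (P : Π y : M, Cotangent E y →L[ℝ] TangentSpace 𝓘(ℝ, E) y) :
    E → (E →L[ℝ] ℝ) →L[ℝ] E :=
  localRep ((E →L[ℝ] ℝ) →L[ℝ] E) (fun y : M => Cotangent E y →L[ℝ] TangentSpace 𝓘(ℝ, E) y) x P

/-- A bundle map `TM → TM` in the preferred chart at `x`. -/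
abbrev endTangentLocalRep (x : M)
    (A : Π y : M, TangentSpace 𝓘(ℝ, E) y →L[ℝ] TangentSpace 𝓘(ℝ, E) y) : E → E →L[ℝ] E :=
  localRep (E →L[ℝ] E) (fun y : M => TangentSpace 𝓘(ℝ, E) y →L[ℝ] TangentSpace 𝓘(ℝ, E) y) x A

/-- A bundle map `T*M → T*M` in the preferred chart at `x`. -/
abbrev endCotangentLocalRep (x : M) (N : Π y : M, Cotangent E y →L[ℝ] Cotangent E y) :
    E → (E →L[ℝ] ℝ) →L[ℝ] (E →L[ℝ] ℝ) :=
  localRep ((E →L[ℝ] ℝ) →L[ℝ] (E →L[ℝ] ℝ)) (fun y : M => Cotangent E y →L[ℝ] Cotangent E y) x N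

theorem bivectorLocalRep_self (x : M)
    (P : Π y : M, Cotangent E y →L[ℝ] TangentSpace 𝓘(ℝ, E) y) :
    bivectorLocalRep x P (extChartAt 𝓘(ℝ, E) x x) = bivectorRep x x (P x) :=
  localRep_self x P

set_option synthInstance.maxHeartbeats 400000 in
theorem endCotangentLocalRep_self (x : M) (N : Π y : M, Cotangent E y →L[ℝ] Cotangent E y) :
    endCotangentLocalRep x N (extChartAt 𝓘(ℝ, E) x x) = endCotangentRep x x (N x) :=
  localRep_self x N

theorem mem_baseSet_tangent {x y : M} (hy : y ∈ (chartAt E x).source) :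
    y ∈ (trivializationAt E (TangentSpace 𝓘(ℝ, E)) x).baseSet := by
  rwa [TangentBundle.trivializationAt_baseSet]

theorem mem_baseSet_cotangent {x y : M} (hy : y ∈ (chartAt E x).source) :
    y ∈ (trivializationAt (E →L[ℝ] ℝ) (Cotangent (M := M) E) x).baseSet :=
  ⟨mem_baseSet_tangent hy, Set.mem_univ _⟩

theorem tangentRep_eq_mfderiv {x y : M} (hy : y ∈ (chartAt E x).source) :
    tangentRep x y = mfderiv 𝓘(ℝ, E) 𝓘(ℝ, E) (extChartAt 𝓘(ℝ, E) x) y :=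
  TangentBundle.continuousLinearMapAt_trivializationAt hy

/-- A covector is a homomorphism into the trivial line bundle, whose trivialization is the identity,
so pairings are unchanged in the chart. -/
theorem cotangentRep_apply {x y : M} (hy : y ∈ (chartAt E x).source) (β : Cotangent E y)
    (v : TangentSpace 𝓘(ℝ, E) y) : cotangentRep x y β (tangentRep x y v) = β v :=
  (fibreRep_clm_apply (F' := ℝ) (V' := fun _ : M => ℝ) (mem_baseSet_tangent hy)
    (Set.mem_univ _) β v).trans (fibreRep_apply (V := fun _ : M => ℝ) (Set.mem_univ _) (β v))

theorem bivectorRep_apply {x y : M} (hy : y ∈ (chartAt E x).source)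
    (P : Cotangent E y →L[ℝ] TangentSpace 𝓘(ℝ, E) y) (β : Cotangent E y) :
    bivectorRep x y P (cotangentRep x y β) = tangentRep x y (P β) :=
  fibreRep_clm_apply (mem_baseSet_cotangent hy) (mem_baseSet_tangent hy) P β

theorem endTangentRep_apply {x y : M} (hy : y ∈ (chartAt E x).source)
    (A : TangentSpace 𝓘(ℝ, E) y →L[ℝ] TangentSpace 𝓘(ℝ, E) y) (v : TangentSpace 𝓘(ℝ, E) y) :
    endTangentRep x y A (tangentRep x y v) = tangentRep x y (A v) :=
  fibreRep_clm_apply (mem_baseSet_tangent hy) (mem_baseSet_tangent hy) A v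

theorem endCotangentRep_apply {x y : M} (hy : y ∈ (chartAt E x).source)
    (N : Cotangent E y →L[ℝ] Cotangent E y) (β : Cotangent E y) :
    endCotangentRep x y N (cotangentRep x y β) = cotangentRep x y (N β) :=
  fibreRep_clm_apply (mem_baseSet_cotangent hy) (mem_baseSet_cotangent hy) N β

theorem tangentRep_surjective {x y : M} (hy : y ∈ (chartAt E x).source) :
    Function.Surjective (tangentRep x y : TangentSpace 𝓘(ℝ, E) y → E) :=
  (fibreRep_bijective (mem_baseSet_tangent hy)).2

theorem cotangentRep_surjective {x y : M} (hy : y ∈ (chartAt E x).source) :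
    Function.Surjective (cotangentRep x y : Cotangent E y → E →L[ℝ] ℝ) :=
  (fibreRep_bijective (mem_baseSet_cotangent hy)).2

theorem cotangentRep_comp {x y : M} (hy : y ∈ (chartAt E x).source) (γ : E →L[ℝ] ℝ) :
    cotangentRep x y (γ.comp (tangentRep x y)) = γ := by
  ext w
  obtain ⟨v, rfl⟩ := tangentRep_surjective hy w
  rw [cotangentRep_apply hy]
  rfl

omit [IsManifold 𝓘(ℝ, E) ∞ M] in
theorem eventually_symm_mem_source (x : M) : ∀ᶠ z in 𝓝 (extChartAt 𝓘(ℝ, E) x x),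
    (extChartAt 𝓘(ℝ, E) x).symm z ∈ (chartAt E x).source :=
  tendsto_extChartAt_symm x (chart_source_mem_nhds E x)

/-- The manifold bracket is defined by pulling fields back through the inverse chart. Near the point
this pullback is the representation in the tangent trivialization, as both are the derivative of the
chart. -/
theorem tangentRep_mlieBracket (X Y : Π y : M, TangentSpace 𝓘(ℝ, E) y) (x : M) :
    tangentRep x x (mlieBracket 𝓘(ℝ, E) X Y x) =
      lieBracket ℝ (fieldLocalRep x X) (fieldLocalRep x Y) (extChartAt 𝓘(ℝ, E) x x) := by
  have hrep : ∀ X : Π y : M, TangentSpace 𝓘(ℝ, E) y,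
      mpullbackWithin 𝓘(ℝ, E) 𝓘(ℝ, E) (extChartAt 𝓘(ℝ, E) x).symm X (Set.range 𝓘(ℝ, E))
        =ᶠ[𝓝 (extChartAt 𝓘(ℝ, E) x x)] fieldLocalRep x X := by
    intro X
    filter_upwards [extChartAt_target_mem_nhds (I := 𝓘(ℝ, E)) x, eventually_symm_mem_source x]
      with z hz hz'
    rw [mpullbackWithin_apply, ContinuousLinearMap.inverse_eq
      (mfderivWithin_extChartAt_symm_comp_mfderiv_extChartAt hz)
      (mfderiv_extChartAt_comp_mfderivWithin_extChartAt_symm hz)]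
    exact (congrArg (fun L : _ →L[ℝ] E => L (X _)) (tangentRep_eq_mfderiv hz')).symm
  rw [← (hrep X).lieBracket_vectorField_eq (hrep Y), tangentRep_eq_mfderiv (mem_chart_source E x),
    ← mlieBracketWithin_univ, mlieBracketWithin_apply, Set.preimage_univ, Set.univ_inter]
  -- The inverse derivative in the definition of the bracket cancels against the derivative of the
  -- chart.
  have hinv := isInvertible_mfderiv_extChartAt (I := 𝓘(ℝ, E))
    (mem_extChartAt_source (I := 𝓘(ℝ, E)) x)
  refine (hinv.self_apply_inverse _).trans ?_
  rw [ModelWithCorners.range_eq_univ]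
  exact congrFun (lieBracketWithin_univ (𝕜 := ℝ) (E := E)) _

/-- Reconciles the pullback used to define `extDerivOne` with the bundle trivialization, so that
both yield the same derivatives at the point. -/
theorem inChart_eventuallyEq (β : Π y : M, Cotangent E y) (x : M) :
    inChart β x =ᶠ[𝓝 (extChartAt 𝓘(ℝ, E) x x)] formLocalRep x β := by
  filter_upwards [extChartAt_target_mem_nhds (I := 𝓘(ℝ, E)) x, eventually_symm_mem_source x]
    with z hz hz'
  ext w
  obtain ⟨v, rfl⟩ := tangentRep_surjective hz' w
  have h := mfderivWithin_extChartAt_symm_comp_mfderiv_extChartAt hz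
  rw [formLocalRep, localRep, cotangentRep_apply hz', inChart, tangentRep_eq_mfderiv hz']
  rw [ModelWithCorners.range_eq_univ, mfderivWithin_univ] at h
  exact congrArg (β _) (congrArg (fun L => L v) h)

/-- Differentiability is asked only of the chart expression at one point, which is what is available
for pairings and Poisson brackets. -/
theorem cotangentRep_differential {x y : M} (hy : y ∈ (chartAt E x).source) {f : M → ℝ}
    (hf : DifferentiableAt ℝ (f ∘ (extChartAt 𝓘(ℝ, E) x).symm) (extChartAt 𝓘(ℝ, E) x y)) :
    cotangentRep x y (differential f y) =
      fderiv ℝ (f ∘ (extChartAt 𝓘(ℝ, E) x).symm) (extChartAt 𝓘(ℝ, E) x y) := by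
  have hev : f =ᶠ[𝓝 y] (f ∘ (extChartAt 𝓘(ℝ, E) x).symm) ∘ extChartAt 𝓘(ℝ, E) x := by
    filter_upwards [(chartAt E x).open_source.mem_nhds hy] with w hw
    simp only [Function.comp_apply]
    rw [(extChartAt 𝓘(ℝ, E) x).left_inv (by rwa [extChartAt_source])]
  have h : differential f y =
      (fderiv ℝ (f ∘ (extChartAt 𝓘(ℝ, E) x).symm) (extChartAt 𝓘(ℝ, E) x y)).comp
        (tangentRep x y) := by
    have := (hf.hasFDerivAt.hasMFDerivAt.comp y
      (mdifferentiableAt_extChartAt (I := 𝓘(ℝ, E)) hy).hasMFDerivAt).congr_of_eventuallyEq hev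
    rw [tangentRep_eq_mfderiv hy]
    ext v
    rw [differential, mvfderiv, this.mfderiv]
    rfl
  rw [h, cotangentRep_comp hy]

end TensorRep

/-! ### Brackets, torsions and the Jacobi identity in a chart -/

section Brackets

variable {E : Type*} [NormedAddCommGroup E] [NormedSpace ℝ E]
  {M : Type*} [TopologicalSpace M] [ChartedSpace E M] [IsManifold 𝓘(ℝ, E) ∞ M]
  {P : Π x : M, Cotangent E x →L[ℝ] TangentSpace 𝓘(ℝ, E) x}
  {N : Π x : M, Cotangent E x →L[ℝ] Cotangent E x} {x : M}

theorem cotangentRep_extDerivOne (β : Π y : M, Cotangent E y) (x : M)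
    (u : TangentSpace 𝓘(ℝ, E) x) :
    cotangentRep x x (extDerivOne β x u) =
      (fderiv ℝ (formLocalRep x β) (extChartAt 𝓘(ℝ, E) x x)
        - (fderiv ℝ (formLocalRep x β) (extChartAt 𝓘(ℝ, E) x x)).flip) (tangentRep x x u) := by
  rw [← (inChart_eventuallyEq β x).fderiv_eq, ← cotangentRep_comp (mem_chart_source E x)
    ((fderiv ℝ (inChart β x) (extChartAt 𝓘(ℝ, E) x x)
        - (fderiv ℝ (inChart β x) (extChartAt 𝓘(ℝ, E) x x)).flip) (tangentRep x x u)),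
    tangentRep_eq_mfderiv (mem_chart_source E x)]
  rfl

theorem pairing_comp_symm_eventuallyEq (P : Π y : M, Cotangent E y →L[ℝ] TangentSpace 𝓘(ℝ, E) y)
    (α β : Π y : M, Cotangent E y) (x : M) :
    (fun y => β y (P y (α y))) ∘ (extChartAt 𝓘(ℝ, E) x).symm =ᶠ[𝓝 (extChartAt 𝓘(ℝ, E) x x)]
      fun z => formLocalRep x β z (bivectorLocalRep x P z (formLocalRep x α z)) := by
  filter_upwards [eventually_symm_mem_source x] with z hz
  simp only [Function.comp_apply, localRep]
  rw [bivectorRep_apply hz, cotangentRep_apply hz]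

theorem eventually_skew (hskew : ∀ (x : M) (α β : Cotangent E x), β (P x α) = -α (P x β)) (x : M) :
    ∀ᶠ z in 𝓝 (extChartAt 𝓘(ℝ, E) x x), ∀ ξ η : E →L[ℝ] ℝ,
      η (bivectorLocalRep x P z ξ) = -ξ (bivectorLocalRep x P z η) := by
  filter_upwards [eventually_symm_mem_source x] with z hz ξ η
  obtain ⟨α, rfl⟩ := cotangentRep_surjective hz ξ
  obtain ⟨β, rfl⟩ := cotangentRep_surjective hz η
  simp only [localRep]
  rw [bivectorRep_apply hz, bivectorRep_apply hz, cotangentRep_apply hz, cotangentRep_apply hz,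
    hskew]

theorem cotangentRep_formBracket
    (hP : DifferentiableAt ℝ (bivectorLocalRep x P) (extChartAt 𝓘(ℝ, E) x x))
    (hskew : ∀ (x : M) (α β : Cotangent E x), β (P x α) = -α (P x β))
    {α β : Π y : M, Cotangent E y}
    (hα : DifferentiableAt ℝ (formLocalRep x α) (extChartAt 𝓘(ℝ, E) x x))
    (hβ : DifferentiableAt ℝ (formLocalRep x β) (extChartAt 𝓘(ℝ, E) x x)) :
    cotangentRep x x (formBracket P α β x) =
      flatBracket (bivectorLocalRep x P) (formLocalRep x α) (formLocalRep x β)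
        (extChartAt 𝓘(ℝ, E) x x) := by
  have hd : ∀ {α β : Π y : M, Cotangent E y},
      DifferentiableAt ℝ (formLocalRep x α) (extChartAt 𝓘(ℝ, E) x x) →
      DifferentiableAt ℝ (formLocalRep x β) (extChartAt 𝓘(ℝ, E) x x) →
      cotangentRep x x (differential (fun y => β y (P y (α y))) x) =
        fderiv ℝ (fun z => formLocalRep x β z (bivectorLocalRep x P z (formLocalRep x α z)))
          (extChartAt 𝓘(ℝ, E) x x) := by
    intro α β hα hβ
    have hev := pairing_comp_symm_eventuallyEq P α β x
    rw [cotangentRep_differential (mem_chart_source E x)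
      ((hβ.clm_apply (hP.clm_apply hα)).congr_of_eventuallyEq hev), hev.fderiv_eq]
  have hv : ∀ α : Π y : M, Cotangent E y, tangentRep x x (P x (α x)) =
      bivectorLocalRep x P (extChartAt 𝓘(ℝ, E) x x)
        (formLocalRep x α (extChartAt 𝓘(ℝ, E) x x)) := by
    intro α
    rw [bivectorLocalRep, formLocalRep, localRep_self, localRep_self,
      bivectorRep_apply (mem_chart_source E x)]
  rw [← cartan_eq_flatBracket hP hα hβ (eventually_skew hskew x), formBracket, lieDeriv, lieDeriv,
    map_sub, map_sub, map_add, map_add, hd hα hβ, hd hβ hα, cotangentRep_extDerivOne,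
    cotangentRep_extDerivOne, hv, hv]

/-- The torsion for the bracket of `1`-forms in the preferred chart. -/
theorem cotangentRep_nijenhuisTorsion
    (hP : DifferentiableAt ℝ (bivectorLocalRep x P) (extChartAt 𝓘(ℝ, E) x x))
    (hskew : ∀ (x : M) (α β : Cotangent E x), β (P x α) = -α (P x β))
    (hN : DifferentiableAt ℝ (endCotangentLocalRep x N) (extChartAt 𝓘(ℝ, E) x x))
    {α β : Π y : M, Cotangent E y} {ξ η : E →L[ℝ] ℝ}
    (hα : formLocalRep x α =ᶠ[𝓝 (extChartAt 𝓘(ℝ, E) x x)] fun _ => ξ)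
    (hβ : formLocalRep x β =ᶠ[𝓝 (extChartAt 𝓘(ℝ, E) x x)] fun _ => η) :
    cotangentRep x x (nijenhuisTorsion (formBracket P) N α β x) =
      nijenhuisTorsion (V := fun _ : E => E →L[ℝ] ℝ) (flatBracket (bivectorLocalRep x P))
        (endCotangentLocalRep x N) (fun _ => ξ) (fun _ => η) (extChartAt 𝓘(ℝ, E) x x) := by
  have hrep : ∀ {α : Π y : M, Cotangent E y} {ξ : E →L[ℝ] ℝ},
      formLocalRep x α =ᶠ[𝓝 (extChartAt 𝓘(ℝ, E) x x)] (fun _ => ξ) →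
      formLocalRep x (fun y => N y (α y)) =ᶠ[𝓝 (extChartAt 𝓘(ℝ, E) x x)]
        fun z => endCotangentLocalRep x N z ξ := by
    intro α ξ hα
    filter_upwards [eventually_symm_mem_source x, hα] with z hz hz'
    rw [← hz']
    exact (endCotangentRep_apply hz _ _).symm
  have hcd : ∀ ξ : E →L[ℝ] ℝ, DifferentiableAt ℝ (fun _ : E => ξ) (extChartAt 𝓘(ℝ, E) x x) :=
    fun ξ => differentiableAt_const ξ
  have hαd := (hcd ξ).congr_of_eventuallyEq hα
  have hβd := (hcd η).congr_of_eventuallyEq hβ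
  have hNαd := (hN.clm_apply (hcd ξ)).congr_of_eventuallyEq (hrep hα)
  have hNβd := (hN.clm_apply (hcd η)).congr_of_eventuallyEq (hrep hβ)
  have hNx : ∀ γ : Cotangent E x, cotangentRep x x (N x γ) =
      endCotangentLocalRep x N (extChartAt 𝓘(ℝ, E) x x) (cotangentRep x x γ) := by
    intro γ
    rw [endCotangentLocalRep_self, endCotangentRep_apply (mem_chart_source E x)]
  rw [nijenhuisTorsion, deformedBracket, map_sub, hNx, map_sub, map_add, hNx,
    cotangentRep_formBracket hP hskew hNαd hNβd, cotangentRep_formBracket hP hskew hNαd hβd,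
    cotangentRep_formBracket hP hskew hαd hNβd, cotangentRep_formBracket hP hskew hαd hβd,
    flatBracket_congr (hrep hα) (hrep hβ), flatBracket_congr (hrep hα) hβ,
    flatBracket_congr hα (hrep hβ), flatBracket_congr hα hβ]
  rfl

/-- The torsion for the Lie bracket of vector fields in the preferred chart. -/
theorem tangentRep_nijenhuisTorsion
    (A : Π y : M, TangentSpace 𝓘(ℝ, E) y →L[ℝ] TangentSpace 𝓘(ℝ, E) y)
    (X Y : Π y : M, TangentSpace 𝓘(ℝ, E) y) (x : M) :
    tangentRep x x (nijenhuisTorsion (mlieBracket 𝓘(ℝ, E)) A X Y x) =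
      nijenhuisTorsion (V := fun _ : E => E) (lieBracket ℝ) (endTangentLocalRep x A)
        (fieldLocalRep x X) (fieldLocalRep x Y) (extChartAt 𝓘(ℝ, E) x x) := by
  have hrep : ∀ X : Π y : M, TangentSpace 𝓘(ℝ, E) y,
      fieldLocalRep x (fun y => A y (X y)) =ᶠ[𝓝 (extChartAt 𝓘(ℝ, E) x x)]
        fun z => endTangentLocalRep x A z (fieldLocalRep x X z) :=
    fun X => localRep_clm_apply (F := E) (F' := E) x A X
  have hAx : ∀ v : TangentSpace 𝓘(ℝ, E) x, tangentRep x x (A x v) =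
      endTangentLocalRep x A (extChartAt 𝓘(ℝ, E) x x) (tangentRep x x v) := by
    intro v
    rw [endTangentLocalRep, localRep_self, endTangentRep_apply (mem_chart_source E x)]
  rw [nijenhuisTorsion, deformedBracket, map_sub, hAx, map_sub, map_add, hAx,
    tangentRep_mlieBracket, tangentRep_mlieBracket, tangentRep_mlieBracket, tangentRep_mlieBracket,
    (hrep X).lieBracket_vectorField_eq (hrep Y),
    (hrep X).lieBracket_vectorField_eq (EventuallyEq.refl _ _),
    (EventuallyEq.refl _ _).lieBracket_vectorField_eq (hrep Y)]
  rfl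

theorem contDiffAt_comp_extChartAt_symm {f : M → ℝ} (hf : ContMDiff 𝓘(ℝ, E) 𝓘(ℝ) ∞ f) (x : M)
    {z : E} (hz : z ∈ (extChartAt 𝓘(ℝ, E) x).target) :
    ContDiffAt ℝ ∞ (f ∘ (extChartAt 𝓘(ℝ, E) x).symm) z :=
  contMDiffAt_iff_contDiffAt.1 (hf.contMDiffAt.comp _ ((contMDiffOn_extChartAt_symm x).contMDiffAt
    ((isOpen_extChartAt_target x).mem_nhds hz)))

theorem cotangentRep_differential_of_contMDiff {f : M → ℝ} (hf : ContMDiff 𝓘(ℝ, E) 𝓘(ℝ) ∞ f)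
    {x y : M} (hy : y ∈ (chartAt E x).source) :
    cotangentRep x y (differential f y) =
      fderiv ℝ (f ∘ (extChartAt 𝓘(ℝ, E) x).symm) (extChartAt 𝓘(ℝ, E) x y) :=
  cotangentRep_differential hy ((contDiffAt_comp_extChartAt_symm hf x
    ((extChartAt 𝓘(ℝ, E) x).map_source (by rwa [extChartAt_source]))).differentiableAt (by simp))

theorem smoothForm_differential {f : M → ℝ} (hf : ContMDiff 𝓘(ℝ, E) 𝓘(ℝ) ∞ f) :
    SmoothForm (E := E) (differential f) := by
  intro x
  refine contMDiffAt_totalSpace.2 ⟨contMDiffAt_id, ?_⟩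
  have h : ContMDiffAt 𝓘(ℝ, E) 𝓘(ℝ, E →L[ℝ] ℝ) ∞
      (fun y => fderiv ℝ (f ∘ (extChartAt 𝓘(ℝ, E) x).symm) (extChartAt 𝓘(ℝ, E) x y)) x :=
    (((contDiffAt_comp_extChartAt_symm hf x (mem_extChartAt_target x)).fderiv_right
      (m := ∞) (by simp)).contMDiffAt).comp x contMDiffAt_extChartAt
  refine h.congr_of_eventuallyEq ?_
  filter_upwards [chart_source_mem_nhds E x] with y hy
  rw [← cotangentRep_differential_of_contMDiff hf hy]
  exact (fibreRep_apply (mem_baseSet_cotangent hy) _).symm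

/-- Linear functions have constant derivative. This supplies the test forms with constant
coefficients near the point. -/
theorem formLocalRep_differential {f : M → ℝ} (hf : ContMDiff 𝓘(ℝ, E) 𝓘(ℝ) ∞ f)
    {ξ : E →L[ℝ] ℝ}
    (hξ : f ∘ (extChartAt 𝓘(ℝ, E) x).symm =ᶠ[𝓝 (extChartAt 𝓘(ℝ, E) x x)] ξ) :
    formLocalRep x (differential f) =ᶠ[𝓝 (extChartAt 𝓘(ℝ, E) x x)] fun _ => ξ := by
  filter_upwards [eventually_symm_mem_source x, extChartAt_target_mem_nhds (I := 𝓘(ℝ, E)) x,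
    hξ.eventuallyEq_nhds] with z hz hz' hz''
  rw [formLocalRep, localRep]
  refine (cotangentRep_differential_of_contMDiff hf hz).trans ?_
  rw [(extChartAt 𝓘(ℝ, E) x).right_inv hz', hz''.fderiv_eq, ContinuousLinearMap.fderiv]

/-- Every linear function in the preferred chart extends from a neighbourhood of the point to a
smooth function. -/
theorem exists_contMDiff_eventuallyEq_linear [FiniteDimensional ℝ E] [T2Space M] (x : M)
    (ξ : E →L[ℝ] ℝ) :
    ∃ f : M → ℝ, ContMDiff 𝓘(ℝ, E) 𝓘(ℝ) ∞ f ∧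
      f ∘ (extChartAt 𝓘(ℝ, E) x).symm =ᶠ[𝓝 (extChartAt 𝓘(ℝ, E) x x)] ξ := by
  obtain ⟨ψ⟩ : Nonempty (SmoothBumpFunction 𝓘(ℝ, E) x) := inferInstance
  -- Cutting off by a bump function extends `ξ` by zero; smoothness of the extension uses that `M`
  -- is Hausdorff.
  refine ⟨fun y => ψ y • ξ (extChartAt 𝓘(ℝ, E) x y), ψ.contMDiff_smul ?_, ?_⟩
  · exact ξ.contMDiff.comp_contMDiffOn contMDiffOn_extChartAt
  · filter_upwards [tendsto_extChartAt_symm x ψ.eventuallyEq_one,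
      extChartAt_target_mem_nhds (I := 𝓘(ℝ, E)) x] with z hz hz'
    have hz1 : ψ ((extChartAt 𝓘(ℝ, E) x).symm z) = 1 := hz
    simp only [Function.comp_apply]
    rw [hz1, (extChartAt 𝓘(ℝ, E) x).right_inv hz', one_smul]

/-- The Jacobi identity in the preferred chart: the Schouten bracket of a Poisson tensor with
itself vanishes. -/
theorem IsPoisson.jacobi_localRep [FiniteDimensional ℝ E] [T2Space M] (hP : IsPoisson P) (x : M)
    (ξ η ζ : E →L[ℝ] ℝ) :
    ζ (fderiv ℝ (bivectorLocalRep x P) (extChartAt 𝓘(ℝ, E) x x)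
        (bivectorLocalRep x P (extChartAt 𝓘(ℝ, E) x x) ξ) η)
      + ξ (fderiv ℝ (bivectorLocalRep x P) (extChartAt 𝓘(ℝ, E) x x)
        (bivectorLocalRep x P (extChartAt 𝓘(ℝ, E) x x) η) ζ)
      + η (fderiv ℝ (bivectorLocalRep x P) (extChartAt 𝓘(ℝ, E) x x)
        (bivectorLocalRep x P (extChartAt 𝓘(ℝ, E) x x) ζ) ξ) = 0 := by
  have hp : DifferentiableAt ℝ (bivectorLocalRep x P) (extChartAt 𝓘(ℝ, E) x x) :=
    differentiableAt_localRep (hP.smooth x)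
  -- For functions linear in the chart, `{g, h}` is `ζ (p η)`, so the outer bracket differentiates
  -- only `p` and no second derivatives of `f`, `g`, `h` occur.
  have key : ∀ {f g h : M → ℝ} {ξ η ζ : E →L[ℝ] ℝ},
      ContMDiff 𝓘(ℝ, E) 𝓘(ℝ) ∞ f → ContMDiff 𝓘(ℝ, E) 𝓘(ℝ) ∞ g →
      ContMDiff 𝓘(ℝ, E) 𝓘(ℝ) ∞ h →
      f ∘ (extChartAt 𝓘(ℝ, E) x).symm =ᶠ[𝓝 (extChartAt 𝓘(ℝ, E) x x)] ξ →
      g ∘ (extChartAt 𝓘(ℝ, E) x).symm =ᶠ[𝓝 (extChartAt 𝓘(ℝ, E) x x)] η →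
      h ∘ (extChartAt 𝓘(ℝ, E) x).symm =ᶠ[𝓝 (extChartAt 𝓘(ℝ, E) x x)] ζ →
      poissonBracket P f (poissonBracket P g h) x =
        ζ (fderiv ℝ (bivectorLocalRep x P) (extChartAt 𝓘(ℝ, E) x x)
          (bivectorLocalRep x P (extChartAt 𝓘(ℝ, E) x x) ξ) η) := by
    intro f g h ξ η ζ hf hg hh hfξ hgη hhζ
    have hev : poissonBracket P g h ∘ (extChartAt 𝓘(ℝ, E) x).symm
        =ᶠ[𝓝 (extChartAt 𝓘(ℝ, E) x x)] fun z => ζ (bivectorLocalRep x P z η) := by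
      filter_upwards [pairing_comp_symm_eventuallyEq P (differential g) (differential h) x,
        formLocalRep_differential hg hgη, formLocalRep_differential hh hhζ] with z hz h1 h2
      rw [h1, h2] at hz
      exact hz
    have hdc : DifferentiableAt ℝ (fun z => ζ (bivectorLocalRep x P z η))
        (extChartAt 𝓘(ℝ, E) x x) :=
      (differentiableAt_const ζ).clm_apply (hp.clm_apply (differentiableAt_const η))
    have hξ : cotangentRep x x (differential f x) = ξ :=
      (localRep_self (V := Cotangent E) x (differential f)).symm.trans
        (formLocalRep_differential hf hfξ).eq_of_nhds
    rw [poissonBracket, ← cotangentRep_apply (mem_chart_source E x),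
      cotangentRep_differential (mem_chart_source E x) (hdc.congr_of_eventuallyEq hev),
      hev.fderiv_eq, ← bivectorRep_apply (mem_chart_source E x), hξ,
      ← bivectorLocalRep_self]
    simpa using fderiv_pairing hp (differentiableAt_const η) (differentiableAt_const ζ) _
  obtain ⟨f, hf, hfξ⟩ := exists_contMDiff_eventuallyEq_linear x ξ
  obtain ⟨g, hg, hgη⟩ := exists_contMDiff_eventuallyEq_linear x η
  obtain ⟨h, hh, hhζ⟩ := exists_contMDiff_eventuallyEq_linear x ζ
  rw [← key hf hg hh hfξ hgη hhζ, ← key hg hh hf hgη hhζ hfξ, ← key hh hf hg hhζ hfξ hgη]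
  exact hP.jacobi f g h hf hg hh x

end Brackets

/-! ### Transposition and its smoothness -/

section TransposeRep

variable {E : Type*} [NormedAddCommGroup E] [NormedSpace ℝ E] [FiniteDimensional ℝ E]

theorem contDiff_of_isLinearMap {F G : Type*} [NormedAddCommGroup F] [NormedSpace ℝ F]
    [FiniteDimensional ℝ F] [NormedAddCommGroup G] [NormedSpace ℝ G] {f : F → G}
    (hf : IsLinearMap ℝ f) : ContDiff ℝ ∞ f :=
  (LinearMap.toContinuousLinearMap (IsLinearMap.mk' f hf)).contDiff

theorem eq_transposeCLM {A : E →L[ℝ] E} {B : (E →L[ℝ] ℝ) →L[ℝ] (E →L[ℝ] ℝ)}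
    (h : ∀ (φ : E →L[ℝ] ℝ) (v : E), φ (A v) = B φ v) : A = transposeCLM B :=
  (existsUnique_transpose B).unique h (apply_transposeCLM B)

/-- The transpose is a chosen element, so linearity comes from uniqueness: sums and multiples of
transposes satisfy the defining pairing. -/
theorem isLinearMap_transposeCLM : IsLinearMap ℝ (transposeCLM (E := E)) where
  map_add _ _ := (eq_transposeCLM fun φ v => by simp [apply_transposeCLM]).symm
  map_smul _ _ := (eq_transposeCLM fun φ v => by simp [apply_transposeCLM]).symm

theorem contDiff_transposeCLM : ContDiff ℝ ∞ (transposeCLM (E := E)) :=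
  contDiff_of_isLinearMap isLinearMap_transposeCLM

variable {M : Type*} [TopologicalSpace M] [ChartedSpace E M] [IsManifold 𝓘(ℝ, E) ∞ M]
  {N : Π x : M, Cotangent E x →L[ℝ] Cotangent E x}

omit [IsManifold 𝓘(ℝ, E) ∞ M] in
theorem apply_transposeBundleMap (N : Π x : M, Cotangent E x →L[ℝ] Cotangent E x) (x : M)
    (β : Cotangent E x) (v : TangentSpace 𝓘(ℝ, E) x) :
    β (transposeBundleMap N x v) = N x β v :=
  apply_transposeCLM (E := E) (N x) β v

/-- Since `cotangentRep` and `tangentRep` preserve the pairing, transposition commutes with passage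
to the chart. -/
theorem endTangentRep_transposeBundleMap {x y : M} (hy : y ∈ (chartAt E x).source) :
    endTangentRep x y (transposeBundleMap N y) = transposeCLM (endCotangentRep x y (N y)) := by
  refine eq_transposeCLM fun φ w => ?_
  obtain ⟨β, rfl⟩ := cotangentRep_surjective hy φ
  obtain ⟨v, rfl⟩ := tangentRep_surjective hy w
  rw [endTangentRep_apply hy, cotangentRep_apply hy, endCotangentRep_apply hy,
    cotangentRep_apply hy, apply_transposeBundleMap]

-- In the chart, `ᵗN` is `N` followed by one fixed linear map between finite-dimensional spaces,
-- which is smooth.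
set_option synthInstance.maxHeartbeats 400000 in
theorem smoothEndTangent_transposeBundleMap (hN : SmoothEndCotangent N) :
    SmoothEndTangent (transposeBundleMap N) := by
  intro x
  refine contMDiffAt_totalSpace.2 ⟨contMDiffAt_id, ?_⟩
  have h := (contDiff_transposeCLM (E := E)).contMDiff.contMDiffAt.comp x
    (contMDiffAt_totalSpace.1 (hN x)).2
  refine h.congr_of_eventuallyEq ?_
  filter_upwards [chart_source_mem_nhds E x] with y hy
  have hT : y ∈ (trivializationAt (E →L[ℝ] E)
      (fun y : M => TangentSpace 𝓘(ℝ, E) y →L[ℝ] TangentSpace 𝓘(ℝ, E) y) x).baseSet :=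
    ⟨mem_baseSet_tangent hy, mem_baseSet_tangent hy⟩
  have hC : y ∈ (trivializationAt ((E →L[ℝ] ℝ) →L[ℝ] (E →L[ℝ] ℝ))
      (fun y : M => Cotangent E y →L[ℝ] Cotangent E y) x).baseSet :=
    ⟨mem_baseSet_cotangent hy, mem_baseSet_cotangent hy⟩
  exact (fibreRep_apply hT _).symm.trans ((endTangentRep_transposeBundleMap hy).trans
    (congrArg transposeCLM (fibreRep_apply hC _)))

end TransposeRep

/-! ### Torsion on the image of `P`, and the theorem -/

set_option synthInstance.maxHeartbeats 400000 in
/-- The torsion of `ᵗN` vanishes on vector fields in the image of `P`. -/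
theorem nijenhuisTorsion_transposeBundleMap_eq_zero {E : Type*} [NormedAddCommGroup E]
    [NormedSpace ℝ E] [FiniteDimensional ℝ E]
    {M : Type*} [TopologicalSpace M] [T2Space M] [ChartedSpace E M] [IsManifold 𝓘(ℝ, E) ∞ M]
    {P : Π x : M, Cotangent E x →L[ℝ] TangentSpace 𝓘(ℝ, E) x} (hP : IsPoisson P)
    {N : Π x : M, Cotangent E x →L[ℝ] Cotangent E x} (hN : IsNijenhuisForForms P N)
    (hcomm : ∀ x : M, (P x).comp (N x) = (transposeBundleMap N x).comp (P x))
    {X Y : Π x : M, TangentSpace 𝓘(ℝ, E) x} (hX : SmoothField X) (hY : SmoothField Y) {x : M}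
    (hXP : X x ∈ Set.range (P x)) (hYP : Y x ∈ Set.range (P x)) :
    nijenhuisTorsion (mlieBracket 𝓘(ℝ, E)) (transposeBundleMap N) X Y x = 0 := by
  obtain ⟨α, hα⟩ := hXP
  obtain ⟨β, hβ⟩ := hYP
  -- The global forms `df` and `dg` have constant coefficients near `x` and take the values `α` and
  -- `β` there.
  obtain ⟨f, hf, hfξ⟩ := exists_contMDiff_eventuallyEq_linear x (cotangentRep x x α)
  obtain ⟨g, hg, hgη⟩ := exists_contMDiff_eventuallyEq_linear x (cotangentRep x x β)
  have hp : DifferentiableAt ℝ (bivectorLocalRep x P) (extChartAt 𝓘(ℝ, E) x x) :=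
    differentiableAt_localRep (hP.smooth x)
  have hn : DifferentiableAt ℝ (endCotangentLocalRep x N) (extChartAt 𝓘(ℝ, E) x x) :=
    differentiableAt_localRep (hN.1 x)
  have htor := cotangentRep_nijenhuisTorsion hp hP.skew hn (formLocalRep_differential hf hfξ)
    (formLocalRep_differential hg hgη)
  rw [hN.2 _ _ (smoothForm_differential hf) (smoothForm_differential hg), map_zero] at htor
  have hval : ∀ {X : Π x : M, TangentSpace 𝓘(ℝ, E) x} {α : Cotangent E x}, P x α = X x →
      bivectorLocalRep x P (extChartAt 𝓘(ℝ, E) x x) (cotangentRep x x α) =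
        fieldLocalRep x X (extChartAt 𝓘(ℝ, E) x x) := by
    intro X α h
    rw [bivectorLocalRep, fieldLocalRep, localRep_self, localRep_self,
      bivectorRep_apply (mem_chart_source E x), h]
  apply (fibreRep_self_bijective (F := E) (V := TangentSpace 𝓘(ℝ, E)) x).1
  rw [map_zero]
  refine (tangentRep_nijenhuisTorsion (transposeBundleMap N) X Y x).trans ?_
  refine nijenhuisTorsion_lieBracket_eq_zero hp
    (differentiableAt_localRep (smoothEndTangent_transposeBundleMap hN.1 x)) hn
    (differentiableAt_localRep (hX x)) (differentiableAt_localRep (hY x))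
    (eventually_skew hP.skew x) (hP.jacobi_localRep x) ?_ (hval hα) (hval hβ) htor.symm
  filter_upwards [eventually_symm_mem_source x] with z hz ξ
  obtain ⟨γ, rfl⟩ := cotangentRep_surjective hz ξ
  simp only [localRep]
  rw [endCotangentRep_apply hz, bivectorRep_apply hz, bivectorRep_apply hz, endTangentRep_apply hz]
  exact congrArg _ (congrArg (fun L => L γ) (hcomm _))

end PoissonContraction

end

theorem theorem15 {E : Type*} [NormedAddCommGroup E] [NormedSpace ℝ E] [FiniteDimensional ℝ E]
    {M : Type*} [TopologicalSpace M] [T2Space M] [ChartedSpace E M] [IsManifold 𝓘(ℝ, E) ∞ M]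
    (P : Π x : M, PoissonContraction.Cotangent E x →L[ℝ] TangentSpace 𝓘(ℝ, E) x)
    (hP : PoissonContraction.IsPoisson P)
    (N : Π x : M, PoissonContraction.Cotangent E x →L[ℝ] PoissonContraction.Cotangent E x)
    (hN : PoissonContraction.IsNijenhuisForForms P N)
    (hcomm : ∀ x : M,
      (P x).comp (N x) = (PoissonContraction.transposeBundleMap N x).comp (P x)) :
    (∀ X Y : Π x : M, TangentSpace 𝓘(ℝ, E) x,
      PoissonContraction.SmoothField X → PoissonContraction.SmoothField Y →
      (∀ x, X x ∈ Set.range (P x)) → (∀ x, Y x ∈ Set.range (P x)) →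
      ∀ x, PoissonContraction.nijenhuisTorsion (mlieBracket 𝓘(ℝ, E))
        (PoissonContraction.transposeBundleMap N) X Y x = 0) ∧
    ((∀ x, Function.Bijective (P x)) →
      (∀ α β : Π x : M, PoissonContraction.Cotangent E x,
        PoissonContraction.SmoothForm α → PoissonContraction.SmoothForm β →
        ∀ x, PoissonContraction.deformedBracket (PoissonContraction.formBracket P) N α β x =
          PoissonContraction.formBracket (fun y => (P y).comp (N y)) α β x) →
      PoissonContraction.IsPoissonNijenhuis P (PoissonContraction.transposeBundleMap N)) := by
  have torsion : ∀ X Y : Π x : M, TangentSpace 𝓘(ℝ, E) x,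
      PoissonContraction.SmoothField X → PoissonContraction.SmoothField Y →
      (∀ x, X x ∈ Set.range (P x)) → (∀ x, Y x ∈ Set.range (P x)) →
      ∀ x, PoissonContraction.nijenhuisTorsion (mlieBracket 𝓘(ℝ, E))
        (PoissonContraction.transposeBundleMap N) X Y x = 0 := fun X Y hX hY hXP hYP x =>
    PoissonContraction.nijenhuisTorsion_transposeBundleMap_eq_zero hP hN hcomm hX hY
      (hXP x) (hYP x)
  -- Turns the `A*` of the Poisson–Nijenhuis conditions back into `N`.
  have hdual : PoissonContraction.dualBundleMap (PoissonContraction.transposeBundleMap N) = N := by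
    funext x
    ext β v
    exact PoissonContraction.apply_transposeBundleMap N x β v
  refine ⟨torsion, fun hbij hcontr => ⟨hP,
    ⟨PoissonContraction.smoothEndTangent_transposeBundleMap hN.1, fun X Y hX hY =>
      torsion X Y hX hY (fun x => (hbij x).2 (X x)) fun x => (hbij x).2 (Y x)⟩, ?_, ?_⟩⟩
  · intro x
    rw [hdual, hcomm]
  -- As `ᵗN P = P N`, the concomitant is the difference of the two contracted brackets.
  · intro α β hα hβ x
    simp only [← hcomm]
    rw [hdual, hcontr α β hα hβ, sub_self]
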